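/- Let $J$ be a finite set and let $\mathsf A=(A_i)_{i\in J}$ be a tuple of real $2\times 2$ matrices with $\max_{i\in J}\|A_i\|<1$, where $\|\cdot\|$ is the Euclidean operator norm. For $A\in M_2(\mathbb R)$ let $\alpha_1(A)\ge\alpha_2(A)\ge 0$ be its singular values, and for $s\ge 0$ put $$\varphi^s(A)=\begin{cases}\alpha_1(A)^s, & 0\le s\le 1,\\ \alpha_1(A)\,\alpha_2(A)^{s-1}, & 1<s\le 2,\\ |\det A|^{s/2}, & s>2,\end{cases}\qquad 0^0=1 .$$ The singular value pressure is $$P(\mathsf A,s)=\lim_{n\to\infty}\frac1n\log\sum_{i_1\cdots i_n\in J^n}\varphi^s(A_{i_1}\cdots A_{i_n})=\inf_{n\ge 1}\frac1n\log\sum_{i_1\cdots i_n\in J^n}\varphi^s(A_{i_1}\cdots A_{i_n})\in[-\infty,\infty),$$ with $\log 0=-\infty$. Let $\mathbb{RP}^1$ be the set of lines through the origin of $\mathbb R^2$. The tuple $\mathsf A$ is irreducible if there is no $V\in\mathbb{RP}^1$ with $A_iV\subset V$ for all $i\in J$. It is dominated if every $A_i$ is non-zero and there is a non-empty proper subset $\mathcal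 C\subset\mathbb{RP}^1$ that is a finite union of closed non-trivial projective intervals (closed arcs that are neither a point nor all of $\mathbb{RP}^1$), such that for all $i\in J$ each line in $\mathcal C$ is mapped by $A_i$ onto a line in the interior of $\mathcal C$. If $\mathsf A$ is dominated or irreducible, then the function $s\mapsto P(\mathsf A,s)$ is continuous at $s=1$ if and only if no $A_i$, $i\in J$, has rank one. -/

import Mathlib

noncomputable section

/-- The largest singular value `α₁(M)` of a real `2 × 2` matrix. -/
def alphaOne (M : Matrix (Fin 2) (Fin 2) ℝ) : ℝ :=
  (Matrix.toEuclideanLin M).singularValues 0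

/-- The smallest singular value `α₂(M)` of a real `2 × 2` matrix. -/
def alphaTwo (M : Matrix (Fin 2) (Fin 2) ℝ) : ℝ :=
  (Matrix.toEuclideanLin M).singularValues 1

/-- The singular value function `φ^s(M)`, for `s ≥ 0`. Here `0 ^ 0 = 1`. -/
def singularValueFunction (s : ℝ) (M : Matrix (Fin 2) (Fin 2) ℝ) : ℝ :=
  if s ≤ 1 then alphaOne M ^ s
  else if s ≤ 2 then alphaOne M * alphaTwo M ^ (s - 1)
  else |M.det| ^ (s / 2)

/-- The product `A_{i₁} A_{i₂} ⋯ A_{iₙ}` along the word `i = i₁ i₂ ⋯ iₙ`. -/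
def wordProd {J : Type*} (A : J → Matrix (Fin 2) (Fin 2) ℝ) {n : ℕ} (i : Fin n → J) :
    Matrix (Fin 2) (Fin 2) ℝ :=
  (List.ofFn fun k => A (i k)).prod

/-- `(1 / n) log ∑_{i ∈ Jⁿ} φ^s(A_i)` as an extended real number, with `log 0 = -∞`. -/
def pressureLevel {J : Type*} [Fintype J] (A : J → Matrix (Fin 2) (Fin 2) ℝ) (s : ℝ) (n : ℕ) :
    EReal :=
  ENNReal.log (ENNReal.ofReal (∑ i : Fin n → J, singularValueFunction s (wordProd A i))) / (n : EReal)

/-- The singular value pressure `P(A, s) ∈ [-∞, ∞)`, for `s ≥ 0`, as the infimum over `n ≥ 1` of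
`(1 / n) log ∑_{i ∈ Jⁿ} φ^s(A_i)`. The sequence `log ∑_{i ∈ Jⁿ} φ^s(A_i)` is sub-additive, so this
infimum is also the limit as `n → ∞`. -/
def pressure {J : Type*} [Fintype J] (A : J → Matrix (Fin 2) (Fin 2) ℝ) (s : ℝ) : EReal :=
  ⨅ n : {n : ℕ // 1 ≤ n}, pressureLevel A s n

/-- The real projective line: the set of lines through the origin of the Euclidean plane. -/
abbrev RPOne : Type := Projectivization ℝ (EuclideanSpace ℝ (Fin 2))

/-- The quotient topology of the projective line. -/
instance instTopologicalSpaceRPOne : TopologicalSpace RPOne :=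
  TopologicalSpace.coinduced (Projectivization.mk' ℝ) inferInstance

/-- `A` maps the line `V` onto the line `W`; in particular `V` is not the kernel of `A`. -/
def MapsLine (M : Matrix (Fin 2) (Fin 2) ℝ) (V W : RPOne) : Prop :=
  V.submodule.map (Matrix.toEuclideanLin M) = W.submodule

/-- A tuple is irreducible if no line `V` satisfies `A_i V ⊆ V` for all `i` (here `A_i V` may be
`{0}`). -/
def IsIrreducibleTuple {J : Type*} (A : J → Matrix (Fin 2) (Fin 2) ℝ) : Prop :=
  ¬ ∃ V : RPOne, ∀ i, V.submodule.map (Matrix.toEuclideanLin (A i)) ≤ V.submodule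

/-- The unit vector `(cos θ, sin θ)`. -/
def unitVec (θ : ℝ) : EuclideanSpace ℝ (Fin 2) := !₂[Real.cos θ, Real.sin θ]

theorem unitVec_ne_zero (θ : ℝ) : unitVec θ ≠ 0 := by
  intro h
  have h0 : Real.cos θ = 0 := by simpa [unitVec] using congrArg (fun v => v 0) h
  have h1 : Real.sin θ = 0 := by simpa [unitVec] using congrArg (fun v => v 1) h
  have h2 := Real.sin_sq_add_cos_sq θ
  simp [h0, h1] at h2

/-- The line through the origin in the direction `(cos θ, sin θ)`. -/
def lineAt (θ : ℝ) : RPOne := Projectivization.mk ℝ (unitVec θ) (unitVec_ne_zero θ)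

/-- A closed non-trivial projective interval: a closed arc of the projective line which is neither
a single point nor everything. (The map `lineAt` has period `π`.) -/
def IsClosedProjInterval (S : Set RPOne) : Prop :=
  ∃ a b : ℝ, a < b ∧ b < a + Real.pi ∧ S = lineAt '' Set.Icc a b

/-- A multicone: a non-empty proper subset of the projective line which is a finite union of closed
non-trivial projective intervals. -/
def IsMulticone (C : Set RPOne) : Prop :=
  C.Nonempty ∧ C ≠ Set.univ ∧
    ∃ F : Set (Set RPOne), F.Finite ∧ (∀ S ∈ F, IsClosedProjInterval S) ∧ C = ⋃₀ F

/-- A tuple is dominated if all its matrices are non-zero and some multicone `C` satisfies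
`A_i C ⊆ interior C` for all `i`: each `A_i` maps every line in `C` onto a line in the interior
of `C`. -/
def IsDominatedTuple {J : Type*} (A : J → Matrix (Fin 2) (Fin 2) ℝ) : Prop :=
  (∀ i, A i ≠ 0) ∧ ∃ C : Set RPOne, IsMulticone C ∧
    ∀ i, ∀ V ∈ C, ∃ W ∈ interior C, MapsLine (A i) V W

end

/-! ### Singular values, operator norm and rank of 2 × 2 matrices -/

noncomputable section

/-! If every singular letter is zero, a nonzero word of length `n` has both singular values in `[exp
(-L n), 1]`, so `φ^s` and `φ^1` differ by at most the factor `exp (|s - 1| L n)` and the pressure is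
Lipschitz-controlled at `1` (`continuousAt_pressure_one`).

Suppose now that `A i₀ = u vᵀ`. For `1 < s ≤ 2` every word containing `i₀` contributes `0`, so `P(A,
s)` is at most the pressure at `1` of the remaining letters. At `s = 1` the words containing `i₀` do
count. Let `a n`, `b n` be the sums of `|v ⬝ W u|` over all words of length `n` and over those
avoiding `i₀`. Cutting at the first `i₀` gives a renewal equation (`wordSum_renewal`), so the series
of `a n x ^ n` diverges once `x ∑ b n x ^ n ≥ 1`. Irreducibility or domination makes `b` comparable
to the norm sums `z n` over words avoiding `i₀` (the two `exists_wordSum_le`). Hence `∑ b n R ^ n`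
diverges at the critical radius `R` of `z`, and some `x < R` already satisfies the criterion
(`exists_lt_and_one_le_mul_sum`). So `P(A, 1)` strictly exceeds the right-hand limit: a jump. -/

theorem Matrix.norm_toEuclideanCLM_eq_alphaOne (M : Matrix (Fin 2) (Fin 2) ℝ) :
    ‖Matrix.toEuclideanCLM (𝕜 := ℝ) M‖ = alphaOne M := by
  set T := Matrix.toEuclideanLin M with hT
  have hs := T.isSymmetric_adjoint_comp_self
  have hfin : Module.finrank ℝ (EuclideanSpace ℝ (Fin 2)) = 2 := by simp
  have hpos : 0 ≤ alphaOne M := T.singularValues_nonneg 0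
  have key : ∀ x, ‖T x‖ ^ 2 = inner ℝ ((LinearMap.adjoint T ∘ₗ T) x) x := by
    intro x
    rw [LinearMap.comp_apply, LinearMap.adjoint_inner_left, real_inner_self_eq_norm_sq]
  set b := hs.eigenvectorBasis hfin
  have hev : ∀ i : Fin 2, hs.eigenvalues hfin i ≤ alphaOne M ^ 2 := by
    intro i
    rw [alphaOne, T.sq_singularValues_of_lt hfin (by norm_num : 0 < 2)]
    exact hs.eigenvalues_antitone hfin (Fin.zero_le i)
  apply le_antisymm
  · refine ContinuousLinearMap.opNorm_le_bound _ hpos fun x => ?_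
    change ‖T x‖ ≤ _
    refine le_of_sq_le_sq ?_ (by positivity)
    -- Parseval in an orthonormal eigenbasis of `T* T`, whose eigenvalues are at most `alphaOne M ^
    -- 2`.
    rw [key, ← b.sum_inner_mul_inner, mul_pow, ← b.sum_sq_norm_inner_right x, Finset.mul_sum]
    refine Finset.sum_le_sum fun i _ => ?_
    have := hs.eigenvectorBasis_apply_self_apply hfin x i
    rw [← real_inner_comm, ← b.repr_apply_apply, this, b.repr_apply_apply]
    have h2 := hev i
    simp only [RCLike.ofReal_real_eq_id, id, Real.norm_eq_abs, sq_abs]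
    nlinarith [sq_nonneg (inner ℝ (b i) x)]
  · have h1 : ‖T (b 0)‖ = alphaOne M := by
      rw [← sq_eq_sq₀ (norm_nonneg _) hpos, key, hs.apply_eigenvectorBasis hfin 0,
        RCLike.ofReal_real_eq_id, id, inner_smul_left, real_inner_self_eq_norm_sq,
        b.orthonormal.1 0, alphaOne, T.sq_singularValues_of_lt hfin (by norm_num : 0 < 2)]
      simp
    rw [← h1]
    have := (Matrix.toEuclideanCLM (𝕜 := ℝ) M).le_opNorm (b 0)
    rw [b.orthonormal.1 0, mul_one] at this
    exact this

theorem alphaOne_nonneg (M : Matrix (Fin 2) (Fin 2) ℝ) : 0 ≤ alphaOne M :=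
  LinearMap.singularValues_nonneg _ _

theorem alphaTwo_nonneg (M : Matrix (Fin 2) (Fin 2) ℝ) : 0 ≤ alphaTwo M :=
  LinearMap.singularValues_nonneg _ _

theorem alphaTwo_le_alphaOne (M : Matrix (Fin 2) (Fin 2) ℝ) : alphaTwo M ≤ alphaOne M :=
  LinearMap.singularValues_antitone _ zero_le_one

theorem alphaOne_mul_alphaTwo (M : Matrix (Fin 2) (Fin 2) ℝ) :
    alphaOne M * alphaTwo M = |M.det| := by
  have h := (Matrix.toEuclideanLin M).normDet_eq_prod_singularValues
  rw [LinearMap.normDet_eq_abs_det, LinearMap.det_toLpLin] at h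
  rw [h]
  simp [Finset.prod_range_succ, alphaOne, alphaTwo]

theorem alphaOne_mul_le (M N : Matrix (Fin 2) (Fin 2) ℝ) :
    alphaOne (M * N) ≤ alphaOne M * alphaOne N := by
  simp only [← Matrix.norm_toEuclideanCLM_eq_alphaOne, map_mul]
  exact norm_mul_le _ _

theorem alphaOne_one : alphaOne 1 = 1 := by
  rw [← Matrix.norm_toEuclideanCLM_eq_alphaOne, map_one, norm_one]

theorem alphaOne_zero : alphaOne 0 = 0 := by
  rw [← Matrix.norm_toEuclideanCLM_eq_alphaOne, map_zero, norm_zero]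

theorem alphaTwo_eq_zero_of_det_eq_zero {M : Matrix (Fin 2) (Fin 2) ℝ} (h : M.det = 0) :
    alphaTwo M = 0 := by
  have h1 := alphaOne_mul_alphaTwo M
  rw [h, abs_zero, mul_eq_zero] at h1
  rcases h1 with h1 | h1
  · exact le_antisymm (h1 ▸ alphaTwo_le_alphaOne M) (alphaTwo_nonneg M)
  · exact h1

/-- The sum of the absolute values of the entries. -/
def entrySum (M : Matrix (Fin 2) (Fin 2) ℝ) : ℝ := ∑ i, ∑ j, |M i j|

theorem entrySum_nonneg (M : Matrix (Fin 2) (Fin 2) ℝ) : 0 ≤ entrySum M := by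
  unfold entrySum; positivity

theorem entrySum_mul_le (M N : Matrix (Fin 2) (Fin 2) ℝ) :
    entrySum (M * N) ≤ entrySum M * entrySum N := by
  simp only [entrySum, Fin.sum_univ_two, Matrix.mul_apply]
  have h : ∀ i j, |M i 0 * N 0 j + M i 1 * N 1 j| ≤ |M i 0| * |N 0 j| + |M i 1| * |N 1 j| := by
    intro i j
    rw [← abs_mul, ← abs_mul]
    exact abs_add_le _ _
  have p : ∀ i j k l, 0 ≤ |M i j| * |N k l| := fun _ _ _ _ => by positivity
  linarith [h 0 0, h 0 1, h 1 0, h 1 1, p 0 0 1 0, p 0 0 1 1, p 0 1 0 0, p 0 1 0 1,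
    p 1 0 1 0, p 1 0 1 1, p 1 1 0 0, p 1 1 0 1]

theorem abs_entry_le_alphaOne (M : Matrix (Fin 2) (Fin 2) ℝ) (i j : Fin 2) :
    |M i j| ≤ alphaOne M := by
  rw [← Matrix.norm_toEuclideanCLM_eq_alphaOne]
  have h := (Matrix.toEuclideanCLM (𝕜 := ℝ) M).le_opNorm (EuclideanSpace.single j 1)
  rw [PiLp.norm_single, norm_one, mul_one] at h
  refine le_trans ?_ ((PiLp.norm_apply_le _ i).trans h)
  rw [Matrix.ofLp_toEuclideanCLM]
  simp

theorem alphaOne_le_entrySum (M : Matrix (Fin 2) (Fin 2) ℝ) : alphaOne M ≤ entrySum M := by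
  rw [← Matrix.norm_toEuclideanCLM_eq_alphaOne]
  refine ContinuousLinearMap.opNorm_le_bound _ (entrySum_nonneg M) fun x => ?_
  have h0 := PiLp.norm_apply_le x 0
  have h1 := PiLp.norm_apply_le x 1
  have hn : ∀ y : EuclideanSpace ℝ (Fin 2), ‖y‖ ≤ |y 0| + |y 1| := by
    intro y
    rw [EuclideanSpace.norm_eq, Fin.sum_univ_two]
    refine Real.sqrt_le_iff.2 ⟨by positivity, ?_⟩
    simp only [Real.norm_eq_abs]
    nlinarith [abs_nonneg (y 0), abs_nonneg (y 1)]
  refine (hn _).trans ?_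
  rw [Matrix.ofLp_toEuclideanCLM]
  simp only [Matrix.mulVec, dotProduct, Fin.sum_univ_two, entrySum, Real.norm_eq_abs] at *
  have h : ∀ i, |M i 0 * x 0 + M i 1 * x 1| ≤ |M i 0| * ‖x‖ + |M i 1| * ‖x‖ := by
    intro i
    refine (abs_add_le _ _).trans ?_
    rw [abs_mul, abs_mul]
    gcongr
  linarith [h 0, h 1]

/-- Multiplication by invertible matrices on both sides changes `alphaOne` by bounded factors. -/
theorem exists_alphaOne_le_entrySum_mul_mul {P Q : Matrix (Fin 2) (Fin 2) ℝ} (hP : P.det ≠ 0)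
    (hQ : Q.det ≠ 0) : ∃ c > 0, ∀ W, c * alphaOne W ≤ entrySum (P * W * Q) := by
  set K := entrySum P⁻¹ * entrySum Q⁻¹ + 1
  have hK : 0 < K := by
    have := mul_nonneg (entrySum_nonneg P⁻¹) (entrySum_nonneg Q⁻¹)
    positivity
  refine ⟨K⁻¹, inv_pos.2 hK, fun W => ?_⟩
  rw [inv_mul_le_iff₀ hK]
  refine (alphaOne_le_entrySum W).trans ?_
  have hW : W = P⁻¹ * (P * W * Q) * Q⁻¹ := by
    rw [← Matrix.mul_assoc, ← Matrix.mul_assoc, Matrix.nonsing_inv_mul _ (isUnit_iff_ne_zero.2 hP),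
      Matrix.one_mul, Matrix.mul_assoc, Matrix.mul_nonsing_inv _ (isUnit_iff_ne_zero.2 hQ),
      Matrix.mul_one]
  have h1 := entrySum_mul_le (P⁻¹ * (P * W * Q)) Q⁻¹
  have h2 := entrySum_mul_le P⁻¹ (P * W * Q)
  have h3 := mul_le_mul_of_nonneg_right h2 (entrySum_nonneg Q⁻¹)
  rw [← hW] at h1
  have := entrySum_nonneg (P * W * Q)
  calc entrySum W ≤ entrySum P⁻¹ * entrySum (P * W * Q) * entrySum Q⁻¹ := h1.trans h3
    _ = (entrySum P⁻¹ * entrySum Q⁻¹) * entrySum (P * W * Q) := by ring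
    _ ≤ K * entrySum (P * W * Q) := by gcongr; simp [K]

theorem exists_eq_vecMulVec_of_det_eq_zero {M : Matrix (Fin 2) (Fin 2) ℝ} (h : M.det = 0)
    (h0 : M ≠ 0) : ∃ u v : Fin 2 → ℝ, u ≠ 0 ∧ v ≠ 0 ∧ M = Matrix.vecMulVec u v := by
  suffices H : ∃ u v : Fin 2 → ℝ, M = Matrix.vecMulVec u v by
    obtain ⟨u, v, rfl⟩ := H
    refine ⟨u, v, ?_, ?_, rfl⟩ <;> rintro rfl <;> simp at h0
  rw [Matrix.det_fin_two] at h
  by_cases h1 : M 0 0 = 0 ∧ M 0 1 = 0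
  · refine ⟨![0, 1], ![M 1 0, M 1 1], ?_⟩
    ext i j
    fin_cases i <;> fin_cases j <;> simp [Matrix.vecMulVec, h1.1, h1.2]
  by_cases h2 : M 0 0 = 0
  · have h3 : M 0 1 ≠ 0 := fun h3 => h1 ⟨h2, h3⟩
    have h4 : M 1 0 = 0 := by
      rw [h2] at h
      have : M 0 1 * M 1 0 = 0 := by linarith
      exact (mul_eq_zero.1 this).resolve_left h3
    refine ⟨![M 0 1, M 1 1], ![0, 1], ?_⟩
    ext i j
    fin_cases i <;> fin_cases j <;> simp [Matrix.vecMulVec, h2, h4]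
  · refine ⟨![1, M 1 0 / M 0 0], ![M 0 0, M 0 1], ?_⟩
    ext i j
    fin_cases i <;> fin_cases j <;> simp [Matrix.vecMulVec]
    · field_simp
    · field_simp
      linarith

theorem rank_eq_one_iff_det_eq_zero_and_ne_zero {M : Matrix (Fin 2) (Fin 2) ℝ} :
    M.rank = 1 ↔ M.det = 0 ∧ M ≠ 0 := by
  constructor
  · intro h
    refine ⟨?_, ?_⟩
    · by_contra hd
      have := Matrix.rank_of_isUnit M ((Matrix.isUnit_iff_isUnit_det M).2 (isUnit_iff_ne_zero.2 hd))
      simp [h] at this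
    · rintro rfl
      simp at h
  · rintro ⟨h, h0⟩
    obtain ⟨u, v, -, -, rfl⟩ := exists_eq_vecMulVec_of_det_eq_zero h h0
    refine le_antisymm (Matrix.rank_vecMulVec_le _ _) (Nat.one_le_iff_ne_zero.2 fun hr => h0 ?_)
    rw [Matrix.rank, Submodule.finrank_eq_zero, LinearMap.range_eq_bot] at hr
    exact Matrix.toLin'.injective (hr.trans (map_zero _).symm)

/-! ### Sums over words, by recursion on the first letter -/

section WordSums

variable {J : Type*} (A : J → Matrix (Fin 2) (Fin 2) ℝ)

/-- The sum of `F (A_{i₁} ⋯ A_{iₙ})` over all words of length `n` with letters in `I`. -/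
def wordSum (I : Finset J) : ℕ → (Matrix (Fin 2) (Fin 2) ℝ → ℝ) → ℝ
  | 0, F => F 1
  | n + 1, F => ∑ j ∈ I, wordSum I n fun W => F (A j * W)

variable {A} {I : Finset J}

theorem wordSum_nonneg {n : ℕ} {F : Matrix (Fin 2) (Fin 2) ℝ → ℝ} (hF : ∀ W, 0 ≤ F W) :
    0 ≤ wordSum A I n F := by
  induction n generalizing F with
  | zero => exact hF 1
  | succ n ih => exact Finset.sum_nonneg fun j _ => ih fun W => hF _

/-- The invariant `p n` holds for every word product of length `n`, so `F` and `G` need only be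
compared there. -/
theorem wordSum_le_of_forall {p : ℕ → Matrix (Fin 2) (Fin 2) ℝ → Prop} (h0 : p 0 1)
    (hp : ∀ n W j, p n W → p (n + 1) (A j * W)) {n : ℕ} {F G : Matrix (Fin 2) (Fin 2) ℝ → ℝ}
    (h : ∀ W, p n W → F W ≤ G W) : wordSum A I n F ≤ wordSum A I n G := by
  induction n generalizing F G with
  | zero => exact h 1 h0
  | succ n ih => exact Finset.sum_le_sum fun j _ => ih fun W hW => h _ (hp n W j hW)

theorem wordSum_mono {n : ℕ} {F G : Matrix (Fin 2) (Fin 2) ℝ → ℝ} (h : ∀ W, F W ≤ G W) :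
    wordSum A I n F ≤ wordSum A I n G :=
  wordSum_le_of_forall (p := fun _ _ => True) trivial (fun _ _ _ _ => trivial) fun W _ => h W

theorem wordSum_const_mul (n : ℕ) (c : ℝ) (F : Matrix (Fin 2) (Fin 2) ℝ → ℝ) :
    wordSum A I n (fun W => c * F W) = c * wordSum A I n F := by
  induction n generalizing F with
  | zero => rfl
  | succ n ih => simp only [wordSum, ih, Finset.mul_sum]

theorem wordSum_add_apply (n : ℕ) (F G : Matrix (Fin 2) (Fin 2) ℝ → ℝ) :
    wordSum A I n (fun W => F W + G W) = wordSum A I n F + wordSum A I n G := by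
  induction n generalizing F G with
  | zero => rfl
  | succ n ih => simp only [wordSum, ih, Finset.sum_add_distrib]

theorem wordSum_succ' (n : ℕ) (F : Matrix (Fin 2) (Fin 2) ℝ → ℝ) :
    wordSum A I (n + 1) F = ∑ j ∈ I, wordSum A I n fun W => F (W * A j) := by
  induction n generalizing F with
  | zero => simp [wordSum]
  | succ n ih =>
    rw [wordSum, Finset.sum_congr rfl fun j _ => ih _, Finset.sum_comm]
    simp only [wordSum, Matrix.mul_assoc]

theorem wordSum_le_succ {n : ℕ} {F : Matrix (Fin 2) (Fin 2) ℝ → ℝ} (hF : ∀ W, 0 ≤ F W) {j : J}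
    (hj : j ∈ I) : wordSum A I n (fun W => F (A j * W)) ≤ wordSum A I (n + 1) F :=
  Finset.single_le_sum (f := fun j => wordSum A I n fun W => F (A j * W))
    (fun _ _ => wordSum_nonneg fun _ => hF _) hj

theorem wordSum_le_succ' {n : ℕ} {F : Matrix (Fin 2) (Fin 2) ℝ → ℝ} (hF : ∀ W, 0 ≤ F W) {j : J}
    (hj : j ∈ I) : wordSum A I n (fun W => F (W * A j)) ≤ wordSum A I (n + 1) F := by
  rw [wordSum_succ']
  exact Finset.single_le_sum (f := fun j => wordSum A I n fun W => F (W * A j))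
    (fun _ _ => wordSum_nonneg fun _ => hF _) hj

/-- A letter outside `I` makes the whole product singular, and `F` vanishes there; only words over
`I` survive. -/
theorem wordSum_le_of_forall_det_eq_zero [Fintype J] {p : Matrix (Fin 2) (Fin 2) ℝ → Prop}
    (h1 : p 1) (hp : ∀ W j, p W → p (A j * W)) {n : ℕ} {F G : Matrix (Fin 2) (Fin 2) ℝ → ℝ}
    (hF : ∀ W, W.det = 0 → F W = 0) (h : ∀ W, p W → F W ≤ G W)
    (hI : ∀ j ∉ I, (A j).det = 0) : wordSum A Finset.univ n F ≤ wordSum A I n G := by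
  induction n generalizing F G with
  | zero => exact h 1 h1
  | succ n ih =>
    simp only [wordSum]
    have h0 : ∀ j ∉ I, wordSum A Finset.univ n (fun W => F (A j * W)) = 0 := by
      intro j hj
      have : (fun W => F (A j * W)) = fun W => 0 * F W := by
        ext W
        rw [zero_mul, hF _ (by rw [Matrix.det_mul, hI j hj, zero_mul])]
      rw [this, wordSum_const_mul, zero_mul]
    rw [← Finset.sum_subset (Finset.subset_univ I) fun j _ hj => h0 j hj]
    exact Finset.sum_le_sum fun j _ => ih (fun W hW => hF _ (by rw [Matrix.det_mul, hW, mul_zero]))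
      fun W hW => h _ (hp W j hW)

theorem wordSum_alphaOne_add_le (m n : ℕ) :
    wordSum A I (m + n) alphaOne ≤ wordSum A I m alphaOne * wordSum A I n alphaOne := by
  -- The inequality is stated for general `F` because the induction replaces `F` by `F (A j * ·)`.
  suffices H : ∀ (m : ℕ) (F : Matrix (Fin 2) (Fin 2) ℝ → ℝ),
      (∀ W W', F (W * W') ≤ F W * alphaOne W') →
      wordSum A I (m + n) F ≤ wordSum A I m F * wordSum A I n alphaOne from
    H m alphaOne alphaOne_mul_le
  intro m
  induction m with
  | zero =>
    intro F hF
    rw [zero_add, wordSum, ← wordSum_const_mul]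
    exact wordSum_mono fun W => by simpa using hF 1 W
  | succ m ih =>
    intro F hF
    rw [Nat.succ_add, wordSum, wordSum, Finset.sum_mul]
    exact Finset.sum_le_sum fun j _ => ih _ fun W W' => by
      rw [← Matrix.mul_assoc]; exact hF _ _

theorem sum_wordProd_eq_wordSum [Fintype J] (n : ℕ) (F : Matrix (Fin 2) (Fin 2) ℝ → ℝ) :
    ∑ i : Fin n → J, F (wordProd A i) = wordSum A Finset.univ n F := by
  induction n generalizing F with
  | zero => simp [wordSum, wordProd]
  | succ n ih =>
    rw [wordSum, ← (Fin.consEquiv fun _ => J).sum_comp, Fintype.sum_prod_type]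
    refine Finset.sum_congr rfl fun j _ => ?_
    rw [← ih]
    simp [wordProd, Fin.consEquiv]

end WordSums

/-! ### Bounds for the pressure in terms of word sums -/

section Pressure

variable {J : Type*} [Fintype J] {A : J → Matrix (Fin 2) (Fin 2) ℝ}

theorem le_pressureLevel_iff {s t : ℝ} {n : ℕ} (hn : 1 ≤ n) :
    (t : EReal) ≤ pressureLevel A s n ↔
      Real.exp (t * n) ≤ wordSum A Finset.univ n (singularValueFunction s) := by
  have hn' : (0 : EReal) < (n : EReal) := by exact_mod_cast hn
  rw [pressureLevel, sum_wordProd_eq_wordSum, EReal.le_div_iff_mul_le hn' (EReal.natCast_ne_top n),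
    ← EReal.coe_coe_eq_natCast, ← EReal.coe_mul, ENNReal.log_ofReal]
  split_ifs with h
  · simp only [le_bot_iff, EReal.coe_ne_bot, false_iff, not_le]
    exact h.trans_lt (Real.exp_pos _)
  · rw [EReal.coe_le_coe_iff, Real.le_log_iff_exp_le (not_le.1 h)]

theorem le_pressure_iff {s t : ℝ} : (t : EReal) ≤ pressure A s ↔
    ∀ n : ℕ, 1 ≤ n → Real.exp (t * n) ≤ wordSum A Finset.univ n (singularValueFunction s) := by
  rw [pressure, le_iInf_iff]
  exact ⟨fun h n hn => (le_pressureLevel_iff hn).1 (h ⟨n, hn⟩),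
    fun h n => (le_pressureLevel_iff n.2).2 (h n n.2)⟩

theorem pressure_le_of_wordSum_lt {s t : ℝ} {n : ℕ} (hn : 1 ≤ n)
    (h : wordSum A Finset.univ n (singularValueFunction s) < Real.exp (t * n)) :
    pressure A s ≤ t := by
  refine (iInf_le _ ⟨n, hn⟩).trans (le_of_not_ge fun h' => ?_)
  exact ((le_pressureLevel_iff hn).1 h').not_gt h

theorem pressure_le_pressure_add {s s' r : ℝ}
    (h : ∀ n, wordSum A Finset.univ n (singularValueFunction s) ≤
      Real.exp (r * n) * wordSum A Finset.univ n (singularValueFunction s')) :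
    pressure A s ≤ pressure A s' + r := by
  -- The pressure may be `-∞`, so the comparison goes through real `t` below it.
  refine EReal.ge_of_forall_gt_iff_ge.1 fun t ht => ?_
  have h1 := le_pressure_iff.1 ht.le
  have h2 : ((t - r : ℝ) : EReal) ≤ pressure A s' := by
    refine le_pressure_iff.2 fun n hn => ?_
    have h3 := (h1 n hn).trans (h n)
    rw [sub_mul, Real.exp_sub, div_le_iff₀ (Real.exp_pos _)]
    linarith
  calc (t : EReal) = ((t - r : ℝ) : EReal) + (r : EReal) := by
        rw [← EReal.coe_add, sub_add_cancel]
    _ ≤ pressure A s' + r := by gcongr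

end Pressure

/-! ### The singular value function near `s = 1` -/

theorem singularValueFunction_one (W : Matrix (Fin 2) (Fin 2) ℝ) :
    singularValueFunction 1 W = alphaOne W := by
  simp [singularValueFunction]

theorem singularValueFunction_zero_right {s : ℝ} (hs : 0 < s) :
    singularValueFunction s 0 = 0 := by
  unfold singularValueFunction
  split_ifs
  · rw [alphaOne_zero, Real.zero_rpow hs.ne']
  · rw [alphaOne_zero, zero_mul]
  · simp [Real.zero_rpow (by positivity : s / 2 ≠ 0)]

theorem singularValueFunction_eq_zero {s : ℝ} (hs : 1 < s) (hs' : s ≤ 2)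
    {W : Matrix (Fin 2) (Fin 2) ℝ} (hW : W.det = 0) : singularValueFunction s W = 0 := by
  rw [singularValueFunction, if_neg hs.not_ge, if_pos hs', alphaTwo_eq_zero_of_det_eq_zero hW,
    Real.zero_rpow (by linarith), mul_zero]

theorem singularValueFunction_le_alphaOne {s : ℝ} (hs : 1 < s) (hs' : s ≤ 2)
    {W : Matrix (Fin 2) (Fin 2) ℝ} (hW : alphaOne W ≤ 1) :
    singularValueFunction s W ≤ alphaOne W := by
  rw [singularValueFunction, if_neg hs.not_ge, if_pos hs']
  exact mul_le_of_le_one_right (alphaOne_nonneg W) (Real.rpow_le_one (alphaTwo_nonneg W)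
    ((alphaTwo_le_alphaOne W).trans hW) (by linarith))

/-- Both singular values lie in `[exp (-T), 1]`, and the ratio of `φ^s` to `φ^1` is the power `s -
1` of one of them. -/
theorem singularValueFunction_bounds {s T : ℝ} (hs2 : s ≤ 2) (hT : 0 ≤ T)
    {W : Matrix (Fin 2) (Fin 2) ℝ} (h1 : alphaOne W ≤ 1) (hd : Real.exp (-T) ≤ |W.det|) :
    singularValueFunction s W ≤ Real.exp (|s - 1| * T) * alphaOne W ∧
      alphaOne W ≤ Real.exp (|s - 1| * T) * singularValueFunction s W := by
  rw [← alphaOne_mul_alphaTwo] at hd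
  have h2 := (alphaTwo_le_alphaOne W).trans h1
  have hexp : 1 ≤ Real.exp (|s - 1| * T) := Real.one_le_exp (by positivity)
  have ha1 : Real.exp (-T) ≤ alphaOne W :=
    hd.trans (mul_le_of_le_one_right (alphaOne_nonneg W) h2)
  have ha2 : Real.exp (-T) ≤ alphaTwo W :=
    hd.trans (mul_le_of_le_one_left (alphaTwo_nonneg W) h1)
  have hpos : 0 < alphaOne W := (Real.exp_pos _).trans_le ha1
  rcases le_or_gt s 1 with hs | hs
  · rw [singularValueFunction, if_pos hs]
    have hle : alphaOne W ≤ alphaOne W ^ s := by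
      simpa using Real.rpow_le_rpow_of_exponent_ge hpos h1 hs
    refine ⟨?_, ?_⟩
    · have e : alphaOne W ^ s * alphaOne W ^ (1 - s) = alphaOne W := by
        rw [← Real.rpow_add hpos]; simp
      have e2 : Real.exp (-(|s - 1| * T)) ≤ alphaOne W ^ (1 - s) := by
        have := Real.rpow_le_rpow (Real.exp_pos _).le ha1 (sub_nonneg.2 hs)
        rw [← Real.exp_mul] at this
        convert this using 2
        rw [abs_of_nonpos (by linarith)]
        ring
      have e3 : alphaOne W ^ s * Real.exp (-(|s - 1| * T)) ≤ alphaOne W := by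
        conv_rhs => rw [← e]
        gcongr
      rwa [Real.exp_neg, ← div_eq_mul_inv, div_le_iff₀ (Real.exp_pos _), mul_comm] at e3
    · exact hle.trans (le_mul_of_one_le_left (by positivity) hexp)
  · refine ⟨(singularValueFunction_le_alphaOne hs hs2 h1).trans
      (le_mul_of_one_le_left hpos.le hexp), ?_⟩
    rw [singularValueFunction, if_neg hs.not_ge, if_pos hs2]
    have e2 : Real.exp (-(|s - 1| * T)) ≤ alphaTwo W ^ (s - 1) := by
      have := Real.rpow_le_rpow (Real.exp_pos _).le ha2 (sub_nonneg.2 hs.le)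
      rw [← Real.exp_mul] at this
      convert this using 2
      rw [abs_of_nonneg (by linarith)]
      ring
    calc alphaOne W = Real.exp (|s - 1| * T) * (alphaOne W * Real.exp (-(|s - 1| * T))) := by
          rw [mul_left_comm, ← Real.exp_add, add_neg_cancel, Real.exp_zero, mul_one]
      _ ≤ _ := by gcongr

/-! ### Continuity without rank one letters -/

section

variable {J : Type*} [Fintype J] {A : J → Matrix (Fin 2) (Fin 2) ℝ}

theorem exists_exp_neg_le_abs_det (A : J → Matrix (Fin 2) (Fin 2) ℝ) :
    ∃ L : ℝ, 0 ≤ L ∧ ∀ i, (A i).det ≠ 0 → Real.exp (-L) ≤ |(A i).det| := by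
  refine ⟨∑ i, |Real.log (|(A i).det|)|, by positivity, fun i hi => ?_⟩
  rw [← Real.le_log_iff_exp_le (abs_pos.2 hi)]
  have := Finset.single_le_sum (f := fun i => |Real.log (|(A i).det|)|) (fun i _ => abs_nonneg _)
    (Finset.mem_univ i)
  have h2 := neg_abs_le (Real.log |(A i).det|)
  linarith

theorem continuousAt_pressure_one (hA : ∀ i, alphaOne (A i) ≤ 1)
    (hrank : ∀ i, (A i).det = 0 → A i = 0) :
    ContinuousAt (fun s : ℝ => pressure A s) 1 := by
  obtain ⟨L, hL, hdet⟩ := exists_exp_neg_le_abs_det A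
  -- A word is zero as soon as one letter is; otherwise its determinant decays at most
  -- exponentially.
  let p : ℕ → Matrix (Fin 2) (Fin 2) ℝ → Prop := fun n W =>
    W = 0 ∨ (alphaOne W ≤ 1 ∧ Real.exp (-(L * n)) ≤ |W.det|)
  have hp0 : p 0 1 := Or.inr (by simp [alphaOne_one])
  have hp : ∀ n W j, p n W → p (n + 1) (A j * W) := by
    rintro n W j (rfl | ⟨h1, h2⟩)
    · exact Or.inl (mul_zero _)
    · by_cases hj : (A j).det = 0
      · exact Or.inl (by rw [hrank j hj, zero_mul])
      · refine Or.inr ⟨(alphaOne_mul_le _ _).trans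
          (mul_le_one₀ (hA j) (alphaOne_nonneg W) h1), ?_⟩
        rw [Matrix.det_mul, abs_mul]
        calc Real.exp (-(L * (n + 1 : ℕ))) = Real.exp (-L) * Real.exp (-(L * n)) := by
              rw [← Real.exp_add]; push_cast; ring_nf
          _ ≤ _ := by gcongr; exact hdet j hj
  have hbound : ∀ s : ℝ, 0 < s → s ≤ 2 →
      pressure A s ≤ pressure A 1 + ((|s - 1| * L : ℝ) : EReal) ∧
      pressure A 1 ≤ pressure A s + ((|s - 1| * L : ℝ) : EReal) := by
    intro s hs hs2
    constructor <;> refine pressure_le_pressure_add fun n => ?_ <;>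
      rw [← wordSum_const_mul] <;> refine wordSum_le_of_forall hp0 hp fun W hW => ?_ <;>
      rcases hW with rfl | ⟨h1, h2⟩
    · simp [singularValueFunction_zero_right, hs]
    · rw [singularValueFunction_one, mul_assoc]
      exact (singularValueFunction_bounds hs2 (by positivity) h1 h2).1
    · simp [singularValueFunction_zero_right, hs]
    · rw [singularValueFunction_one, mul_assoc]
      exact (singularValueFunction_bounds hs2 (by positivity) h1 h2).2
  have hlim : Filter.Tendsto (fun s : ℝ => ((|s - 1| * L : ℝ) : EReal)) (nhds 1) (nhds 0) := by
    have : Filter.Tendsto (fun s : ℝ => |s - 1| * L) (nhds 1) (nhds (|(1 : ℝ) - 1| * L)) :=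
      Continuous.tendsto (by fun_prop) 1
    simp only [sub_self, abs_zero, zero_mul] at this
    exact_mod_cast (continuous_coe_real_ereal.tendsto 0).comp this
  have hlim' : Filter.Tendsto (fun s : ℝ => -((|s - 1| * L : ℝ) : EReal)) (nhds 1) (nhds 0) := by
    simpa using hlim.neg
  have hadd : ∀ f : ℝ → EReal, Filter.Tendsto f (nhds 1) (nhds 0) →
      Filter.Tendsto (fun s => pressure A 1 + f s) (nhds 1) (nhds (pressure A 1)) := by
    intro f hf
    -- Addition is continuous here even if the pressure is infinite, since the other limit is
    -- finite.
    have := (EReal.continuousAt_add (p := (pressure A 1, 0)) (by simp) (by simp)).tendsto.comp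
      ((tendsto_const_nhds (x := pressure A 1)).prodMk_nhds hf)
    simpa [Function.comp_def] using this
  have hnear : ∀ᶠ s : ℝ in nhds 1, 0 < s ∧ s ≤ 2 :=
    Filter.Eventually.and (eventually_gt_nhds one_pos) (eventually_le_nhds one_lt_two)
  refine tendsto_of_tendsto_of_tendsto_of_le_of_le' (hadd _ hlim') (hadd _ hlim) ?_ ?_
  · filter_upwards [hnear] with s hs
    exact EReal.sub_le_of_le_add (hbound s hs.1 hs.2).2
  · filter_upwards [hnear] with s hs
    exact (hbound s hs.1 hs.2).1

end

/-! ### Power series and the renewal criterion -/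

section Sequences

/-- Otherwise `∑ b n R ^ n ≤ 1 / R` at the critical radius `R = sup X` of `z`, so `b n R ^ n → 0`.
But `z n R ^ n ≥ 1` for all `n`, which the comparison `h` forbids. -/
theorem exists_lt_and_one_le_mul_sum {b z : ℕ → ℝ} {c : ℝ} (hb : ∀ n, 0 ≤ b n)
    (hz : ∀ n, 0 ≤ z n) (hz0 : 1 ≤ z 0) (hc : 0 < c)
    (h : ∀ n, c * z n ≤ b n + 2 * b (n + 1) + b (n + 2)) :
    ∃ x y : ℝ, 0 < x ∧ x < y ∧ (∃ m, 1 ≤ m ∧ z m * y ^ m < 1) ∧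
      ∃ N, 1 ≤ x * ∑ n ∈ Finset.range N, b n * x ^ n := by
  by_contra! hcon
  set X : Set ℝ := {y | 0 < y ∧ ∃ m, 1 ≤ m ∧ z m * y ^ m < 1} with hX
  have hlt : ∀ y ∈ X, ∀ x, 0 < x → x < y → ∀ N, x * ∑ n ∈ Finset.range N, b n * x ^ n < 1 :=
    fun y hy x hx hxy N => hcon x y hx hxy hy.2 N
  have hne : (1 / (z 1 + 1)) ∈ X := by
    have := hz 1
    refine ⟨by positivity, 1, le_rfl, ?_⟩
    rw [pow_one, mul_one_div, div_lt_one (by positivity)]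
    linarith
  obtain ⟨k, hk⟩ : ∃ k, 0 < b k := by
    by_contra! hb'
    have := h 0
    have h1 := hb' 0
    have h2 := hb' 1
    have h3 := hb' 2
    simp only [zero_add] at this
    nlinarith
  -- A single term `b k > 0` gives `K * b k * K ^ k ≥ 1` at `K = max 1 (1 / b k)`, so no element of
  -- `X` exceeds `K`.
  have hbdd : BddAbove X := by
    refine ⟨max 1 (1 / b k), fun y hy => not_lt.1 fun hlt' => ?_⟩
    set K := max 1 (1 / b k)
    have hK1 : 1 ≤ K := le_max_left _ _
    have hK2 : 1 ≤ K * b k := (div_le_iff₀ hk).1 (le_max_right _ _)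
    have h1 := hlt y hy K (by linarith) hlt' (k + 1)
    have h2 : b k * K ^ k ≤ ∑ n ∈ Finset.range (k + 1), b n * K ^ n :=
      Finset.single_le_sum (f := fun n => b n * K ^ n)
        (fun n _ => mul_nonneg (hb n) (by positivity)) (Finset.self_mem_range_succ k)
    have h3 : b k ≤ b k * K ^ k := le_mul_of_one_le_right hk.le (one_le_pow₀ hK1)
    have h4 : K * b k ≤ K * ∑ n ∈ Finset.range (k + 1), b n * K ^ n := by
      gcongr
      exact h3.trans h2
    linarith
  set R := sSup X
  have hR : 0 < R := hne.1.trans_le (le_csSup hbdd hne)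
  -- The strict inequality defining `X` persists slightly to the right of `R`.
  have hRX : R ∉ X := by
    rintro ⟨-, m, hm, hm'⟩
    have hcont : Filter.Tendsto (fun y : ℝ => z m * y ^ m) (nhdsWithin R (Set.Ioi R))
        (nhds (z m * R ^ m)) :=
      (Continuous.tendsto (by fun_prop) R).mono_left nhdsWithin_le_nhds
    obtain ⟨y, hy, hyR⟩ := ((hcont.eventually (gt_mem_nhds hm')).and
      self_mem_nhdsWithin).exists
    have hyR' : R < y := hyR
    exact (le_csSup hbdd (show y ∈ X from ⟨hR.trans hyR', m, hm, hy⟩)).not_gt hyR'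
  have hzR : ∀ n, 1 ≤ z n * R ^ n := by
    intro n
    rcases Nat.eq_zero_or_pos n with rfl | hn
    · simpa using hz0
    · by_contra! hlt'
      exact hRX ⟨hR, n, hn, hlt'⟩
  have hpart : ∀ N, ∑ n ∈ Finset.range N, b n * R ^ n ≤ 1 / R := by
    intro N
    rw [le_div_iff₀' hR]
    have hcont : Filter.Tendsto (fun x : ℝ => x * ∑ n ∈ Finset.range N, b n * x ^ n)
        (nhdsWithin R (Set.Iio R)) (nhds (R * ∑ n ∈ Finset.range N, b n * R ^ n)) :=
      (Continuous.tendsto (by fun_prop) R).mono_left nhdsWithin_le_nhds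
    refine le_of_tendsto hcont ?_
    filter_upwards [Ioo_mem_nhdsLT hR] with x hx
    obtain ⟨y, hy, hxy⟩ := exists_lt_of_lt_csSup ⟨_, hne⟩ hx.2
    exact (hlt y hy x hx.1 hxy N).le
  have hsum : Summable fun n => b n * R ^ n :=
    summable_of_sum_range_le (fun n => mul_nonneg (hb n) (by positivity)) hpart
  have ht := hsum.tendsto_atTop_zero
  have ht' : Filter.Tendsto (fun n => b n * R ^ n + 2 / R * (b (n + 1) * R ^ (n + 1)) +
      1 / R ^ 2 * (b (n + 2) * R ^ (n + 2))) Filter.atTop (nhds 0) := by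
    have := (ht.add (((Filter.tendsto_add_atTop_iff_nat 1).2 ht).const_mul (2 / R))).add
      (((Filter.tendsto_add_atTop_iff_nat 2).2 ht).const_mul (1 / R ^ 2))
    simpa using this
  refine (ge_of_tendsto' ht' (fun n => ?_) : c ≤ 0).not_gt hc
  have h1 : c ≤ c * z n * R ^ n := by
    rw [mul_assoc]; exact le_mul_of_one_le_right hc.le (hzR n)
  refine h1.trans ((mul_le_mul_of_nonneg_right (h n) (by positivity)).trans_eq ?_)
  field_simp
  ring

/-- Convergence would give `S = B + x B S` for the two generating functions, impossible when `x B ≥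
1` and `B > 0`. -/
theorem not_summable_of_renewal {a b : ℕ → ℝ} {x : ℝ} (ha : ∀ n, 0 ≤ a n) (hb : ∀ n, 0 ≤ b n)
    (hx : 0 < x) (h0 : a 0 = b 0)
    (h : ∀ n, a (n + 1) = b (n + 1) + ∑ p ∈ Finset.HasAntidiagonal.antidiagonal n, b p.1 * a p.2)
    {N : ℕ} (hN : 1 ≤ x * ∑ n ∈ Finset.range N, b n * x ^ n) :
    ¬ Summable fun n => a n * x ^ n := by
  intro hsa
  have hle : ∀ n, b n * x ^ n ≤ a n * x ^ n := by
    intro n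
    gcongr
    cases n with
    | zero => exact h0.ge
    | succ n =>
      rw [h, le_add_iff_nonneg_right]
      exact Finset.sum_nonneg fun p _ => mul_nonneg (hb _) (ha _)
  have hb' : ∀ n, 0 ≤ b n * x ^ n := fun n => mul_nonneg (hb n) (by positivity)
  have ha' : ∀ n, 0 ≤ a n * x ^ n := fun n => mul_nonneg (ha n) (by positivity)
  have hsb : Summable fun n => b n * x ^ n := Summable.of_nonneg_of_le hb' hle hsa
  have hprod := hsb.tsum_mul_tsum_eq_tsum_sum_antidiagonal hsa
    (hsb.mul_of_nonneg hsa hb' ha')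
  have hsc : Summable fun n => ∑ p ∈ Finset.HasAntidiagonal.antidiagonal n,
      b p.1 * x ^ p.1 * (a p.2 * x ^ p.2) :=
    summable_sum_mul_antidiagonal_of_summable_mul (f := fun n => b n * x ^ n)
      (g := fun n => a n * x ^ n) (hsb.mul_of_nonneg hsa hb' ha')
  have e1 : ∑' n, a n * x ^ n = ∑' n, b n * x ^ n +
      x * ((∑' n, b n * x ^ n) * ∑' n, a n * x ^ n) := by
    rw [hprod, ← tsum_mul_left, hsa.tsum_eq_zero_add, hsb.tsum_eq_zero_add, h0, add_assoc,
      ← ((summable_nat_add_iff 1).2 hsb).tsum_add (hsc.mul_left x)]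
    congr 2
    ext n
    rw [h, add_mul, Finset.sum_mul, Finset.mul_sum]
    congr 1
    refine Finset.sum_congr rfl fun p hp => ?_
    rw [← Finset.HasAntidiagonal.mem_antidiagonal.1 hp]
    ring
  have hBN : ∑ n ∈ Finset.range N, b n * x ^ n ≤ ∑' n, b n * x ^ n :=
    hsb.sum_le_tsum _ fun n _ => hb' n
  have hA0 : 0 ≤ ∑' n, a n * x ^ n := tsum_nonneg ha'
  have hxB : 1 ≤ x * ∑' n, b n * x ^ n := hN.trans (by gcongr)
  generalize ∑' n, b n * x ^ n = B at *
  generalize ∑' n, a n * x ^ n = S at *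
  have hB0 : 0 < B := pos_of_mul_pos_right (zero_lt_one.trans_le hxB) hx.le
  have h1 : S ≤ x * B * S := le_mul_of_one_le_left hA0 hxB
  linarith [mul_assoc x B S]

/-- Partial sums satisfy `S_N ≤ S_m + z m * S_N`. -/
theorem summable_of_submultiplicative {z : ℕ → ℝ} (hz : ∀ n, 0 ≤ z n)
    (hmul : ∀ m n, z (m + n) ≤ z m * z n) {m : ℕ} (hm : z m < 1) : Summable z := by
  refine summable_of_sum_range_le (c := (∑ n ∈ Finset.range m, z n) / (1 - z m)) hz fun N => ?_
  rw [le_div_iff₀ (by linarith)]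
  have h1 : ∑ n ∈ Finset.range N, z n ≤ ∑ n ∈ Finset.range (m + N), z n :=
    Finset.sum_le_sum_of_subset_of_nonneg (Finset.range_mono (by omega)) fun n _ _ => hz n
  rw [Finset.sum_range_add] at h1
  have h2 : ∑ n ∈ Finset.range N, z (m + n) ≤ z m * ∑ n ∈ Finset.range N, z n := by
    rw [Finset.mul_sum]
    exact Finset.sum_le_sum fun n _ => hmul m n
  linarith

end Sequences

/-! ### The renewal equation at a rank one letter -/

section Renewal

open Matrix

variable {J : Type*} [Fintype J] [DecidableEq J] {A : J → Matrix (Fin 2) (Fin 2) ℝ}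

/-- Cut each word at its first `i₀`: the factor `u vᵀ` splits `x ⬝ W u` into a product. The vector
`x` is free because the first letter acts on it in the induction. -/
theorem wordSum_renewal {i₀ : J} {u v : Fin 2 → ℝ} (hi : A i₀ = vecMulVec u v) (n : ℕ)
    (x : Fin 2 → ℝ) :
    wordSum A Finset.univ (n + 1) (fun W => |x ⬝ᵥ W *ᵥ u|) =
      wordSum A (Finset.univ.erase i₀) (n + 1) (fun W => |x ⬝ᵥ W *ᵥ u|) +
        ∑ p ∈ Finset.HasAntidiagonal.antidiagonal n, wordSum A (Finset.univ.erase i₀) p.1 (fun W => |x ⬝ᵥ W *ᵥ u|) *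
          wordSum A Finset.univ p.2 (fun W => |v ⬝ᵥ W *ᵥ u|) := by
  have hmul : ∀ (x : Fin 2 → ℝ) (M W : Matrix (Fin 2) (Fin 2) ℝ),
      |x ⬝ᵥ (M * W) *ᵥ u| = |(x ᵥ* M) ⬝ᵥ W *ᵥ u| := by
    intro x M W
    rw [← mulVec_mulVec, dotProduct_mulVec]
  have hstep : ∀ (I : Finset J) (n : ℕ) (x : Fin 2 → ℝ),
      wordSum A I (n + 1) (fun W => |x ⬝ᵥ W *ᵥ u|) =
        ∑ j ∈ I, wordSum A I n (fun W => |(x ᵥ* A j) ⬝ᵥ W *ᵥ u|) := by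
    intro I n x
    simp only [wordSum, hmul]
  have hi₀ : ∀ (n : ℕ) (x : Fin 2 → ℝ),
      wordSum A Finset.univ n (fun W => |(x ᵥ* A i₀) ⬝ᵥ W *ᵥ u|) =
        wordSum A (Finset.univ.erase i₀) 0 (fun W => |x ⬝ᵥ W *ᵥ u|) *
          wordSum A Finset.univ n (fun W => |v ⬝ᵥ W *ᵥ u|) := by
    intro n x
    rw [← wordSum_const_mul]
    simp only [wordSum, one_mulVec, hi, vecMul_vecMulVec, smul_dotProduct, smul_eq_mul, abs_mul]
  induction n generalizing x with
  | zero =>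
    rw [hstep, ← Finset.sum_erase_add _ _ (Finset.mem_univ i₀), hi₀, hstep,
      Finset.Nat.antidiagonal_zero, Finset.sum_singleton]
    rfl
  | succ n ih =>
    rw [hstep, ← Finset.sum_erase_add _ _ (Finset.mem_univ i₀), hi₀,
      Finset.sum_congr rfl fun j _ => ih _, Finset.sum_add_distrib, Finset.sum_comm,
      Finset.Nat.sum_antidiagonal_succ, hstep]
    simp only [hstep, Finset.sum_mul]
    ring

end Renewal

/-! ### The jump of the pressure -/

section Discontinuity

open Matrix

variable {J : Type*} [Fintype J] [DecidableEq J] {A : J → Matrix (Fin 2) (Fin 2) ℝ}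

theorem abs_dotProduct_mulVec_le (v u : Fin 2 → ℝ) (W : Matrix (Fin 2) (Fin 2) ℝ) :
    |v ⬝ᵥ W *ᵥ u| ≤ ((|v 0| + |v 1|) * (|u 0| + |u 1|)) * alphaOne W := by
  have h := abs_entry_le_alphaOne W
  have hrow : ∀ i, |(W *ᵥ u) i| ≤ (|u 0| + |u 1|) * alphaOne W := by
    intro i
    simp only [mulVec, dotProduct, Fin.sum_univ_two]
    refine (abs_add_le _ _).trans ?_
    rw [abs_mul, abs_mul, add_mul, mul_comm |u 0|, mul_comm |u 1|]
    gcongr <;> exact h _ _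
  simp only [dotProduct, Fin.sum_univ_two]
  refine (abs_add_le _ _).trans ?_
  rw [abs_mul, abs_mul, mul_assoc, add_mul]
  gcongr <;> exact hrow _

/-- A quantitative lower bound on the words avoiding a rank one letter forces a jump of the
pressure at `1`. -/
theorem not_continuousAt_pressure_one (hA : ∀ i, alphaOne (A i) ≤ 1) {i₀ : J} {u v : Fin 2 → ℝ}
    (hi : A i₀ = vecMulVec u v) {c : ℝ} (hc : 0 < c)
    (hkey : ∀ n, c * wordSum A (Finset.univ.erase i₀) n alphaOne ≤
      wordSum A (Finset.univ.erase i₀) n (fun W => |v ⬝ᵥ W *ᵥ u|) +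
      2 * wordSum A (Finset.univ.erase i₀) (n + 1) (fun W => |v ⬝ᵥ W *ᵥ u|) +
      wordSum A (Finset.univ.erase i₀) (n + 2) (fun W => |v ⬝ᵥ W *ᵥ u|)) :
    ¬ ContinuousAt (fun s : ℝ => pressure A s) 1 := by
  obtain ⟨x, y, hx, hxy, ⟨m, hm, hmy⟩, N, hN⟩ := exists_lt_and_one_le_mul_sum
    (fun n => wordSum_nonneg (A := A) (I := Finset.univ.erase i₀) fun W => abs_nonneg _)
    (fun n => wordSum_nonneg alphaOne_nonneg) (by simp [wordSum, alphaOne_one]) hc hkey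
  have hy : 0 < y := hx.trans hxy
  have hexp : ∀ (w : ℝ), 0 < w → ∀ n : ℕ, Real.exp (-Real.log w * n) = (w ^ n)⁻¹ := by
    intro w hw n
    rw [mul_comm, Real.exp_nat_mul, Real.exp_neg, Real.exp_log hw, inv_pow]
  -- If one norm sum fell below `x ^ (-n)`, submultiplicativity would make the norm series at `x`
  -- converge, and with it the dominated renewal series.
  have hP1 : ((-Real.log x : ℝ) : EReal) ≤ pressure A 1 := by
    refine le_pressure_iff.2 fun n hn => ?_
    by_contra! hlt
    rw [hexp x hx, show singularValueFunction 1 = alphaOne from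
      funext singularValueFunction_one, ← one_div, lt_div_iff₀ (by positivity)] at hlt
    have hsum : Summable fun k => wordSum A Finset.univ k alphaOne * x ^ k := by
      refine summable_of_submultiplicative
        (fun k => mul_nonneg (wordSum_nonneg alphaOne_nonneg) (by positivity)) (fun k l => ?_) hlt
      calc wordSum A Finset.univ (k + l) alphaOne * x ^ (k + l)
          ≤ wordSum A Finset.univ k alphaOne * wordSum A Finset.univ l alphaOne * x ^ (k + l) := by
            gcongr
            exact wordSum_alphaOne_add_le k l
        _ = _ := by ring
    refine not_summable_of_renewal (a := fun k => wordSum A Finset.univ k fun W => |v ⬝ᵥ W *ᵥ u|)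
      (fun k => wordSum_nonneg fun W => abs_nonneg _) (fun k => wordSum_nonneg fun W => abs_nonneg _)
      hx rfl (fun k => wordSum_renewal hi k v) hN ?_
    refine Summable.of_nonneg_of_le
      (fun k => mul_nonneg (wordSum_nonneg fun W => abs_nonneg _) (by positivity)) (fun k => ?_)
      (hsum.mul_left ((|v 0| + |v 1|) * (|u 0| + |u 1|)))
    rw [← mul_assoc, ← wordSum_const_mul]
    gcongr
    exact wordSum_mono fun W => abs_dotProduct_mulVec_le v u W
  have hPs : ∀ s : ℝ, 1 < s → s ≤ 2 → pressure A s ≤ ((-Real.log y : ℝ) : EReal) := by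
    intro s hs hs2
    refine pressure_le_of_wordSum_lt hm ?_
    rw [hexp y hy, ← one_div, lt_div_iff₀ (by positivity)]
    refine lt_of_le_of_lt ?_ hmy
    gcongr
    refine wordSum_le_of_forall_det_eq_zero (p := fun W => alphaOne W ≤ 1) alphaOne_one.le
      (fun W j hW => (alphaOne_mul_le _ _).trans (mul_le_one₀ (hA j) (alphaOne_nonneg W) hW))
      (fun W => singularValueFunction_eq_zero hs hs2)
      (fun W => singularValueFunction_le_alphaOne hs hs2) fun j hj => ?_
    obtain rfl : j = i₀ := by simpa using hj
    rw [hi, det_vecMulVec]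
  intro hcont
  have h1 : Filter.Tendsto (fun s : ℝ => pressure A s) (nhdsWithin 1 (Set.Ioi 1))
      (nhds (pressure A 1)) := hcont.mono_left nhdsWithin_le_nhds
  have h2 : pressure A 1 ≤ ((-Real.log y : ℝ) : EReal) := by
    refine le_of_tendsto h1 ?_
    filter_upwards [Ioc_mem_nhdsGT one_lt_two] with s hs
    exact hPs s hs.1 hs.2
  have h3 := hP1.trans h2
  rw [EReal.coe_le_coe_iff] at h3
  linarith [Real.log_lt_log hx hxy]

end Discontinuity

/-! ### The comparison for irreducible tuples -/

section Irreducible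

open Matrix

variable {J : Type*} {A : J → Matrix (Fin 2) (Fin 2) ℝ}

theorem IsIrreducibleTuple.exists_mulVec_ne_smul (h : IsIrreducibleTuple A) {u : Fin 2 → ℝ}
    (hu : u ≠ 0) : ∃ i, ∀ t : ℝ, A i *ᵥ u ≠ t • u := by
  by_contra! hcon
  have hu' : WithLp.toLp 2 u ≠ 0 := by simpa using hu
  refine h ⟨Projectivization.mk ℝ (WithLp.toLp 2 u) hu', fun i => ?_⟩
  rw [Projectivization.submodule_mk, Submodule.map_span_le]
  intro m hm
  rw [Set.mem_singleton_iff.1 hm, Submodule.mem_span_singleton]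
  obtain ⟨t, ht⟩ := hcon i
  exact ⟨t, by rw [Matrix.toLpLin_toLp, Matrix.toLin'_apply, ht]; rfl⟩

theorem exists_smul_eq_of_det_eq_zero {u w : Fin 2 → ℝ} (hu : u ≠ 0)
    (h : u 0 * w 1 - u 1 * w 0 = 0) : ∃ t : ℝ, w = t • u := by
  by_cases h0 : u 0 = 0
  · have h1 : u 1 ≠ 0 := fun h1 => hu (by ext i; fin_cases i <;> simp [h0, h1])
    refine ⟨w 1 / u 1, ?_⟩
    have hw : w 0 = 0 := by
      rw [h0] at h
      have : u 1 * w 0 = 0 := by linarith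
      exact (mul_eq_zero.1 this).resolve_left h1
    ext i
    fin_cases i
    · simp [h0, hw]
    · simp [h1]
  · refine ⟨w 0 / u 0, ?_⟩
    ext i
    fin_cases i
    · simp [h0]
    · simp only [Fin.mk_one, Pi.smul_apply, smul_eq_mul]
      field_simp
      linarith

/-- Some `A l` moves the line of `u` and some `A k` moves the kernel of `vᵀ`. Then `P` with rows
`v`, `vᵀ A k` and `Q` with columns `u`, `A l u` are invertible, so the entries of `P W Q` control
the norm of `W`. They are the pairings of `W`, `A k W`, `W A l`, `A k W A l`, whence the weights `1,
2, 1`. -/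
theorem IsIrreducibleTuple.exists_wordSum_le [Fintype J] [DecidableEq J]
    (h : IsIrreducibleTuple A) {i₀ : J}
    {u v : Fin 2 → ℝ} (hi : A i₀ = vecMulVec u v) (hu : u ≠ 0) (hv : v ≠ 0) :
    ∃ c > 0, ∀ n, c * wordSum A (Finset.univ.erase i₀) n alphaOne ≤
      wordSum A (Finset.univ.erase i₀) n (fun W => |v ⬝ᵥ W *ᵥ u|) +
      2 * wordSum A (Finset.univ.erase i₀) (n + 1) (fun W => |v ⬝ᵥ W *ᵥ u|) +
      wordSum A (Finset.univ.erase i₀) (n + 2) (fun W => |v ⬝ᵥ W *ᵥ u|) := by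
  obtain ⟨l, hl⟩ := h.exists_mulVec_ne_smul hu
  have hv' : ![-v 1, v 0] ≠ 0 := by
    intro h0
    apply hv
    ext i
    fin_cases i
    · simpa using congrFun h0 1
    · simpa using congrFun h0 0
  obtain ⟨k, hk⟩ := h.exists_mulVec_ne_smul hv'
  have hli : l ∈ Finset.univ.erase i₀ := by
    -- The letter `i₀` itself preserves the line of `u`, so `l ≠ i₀`; likewise `k ≠ i₀` below, as `A
    -- i₀` kills its kernel.
    refine Finset.mem_erase.2 ⟨?_, Finset.mem_univ _⟩
    rintro rfl
    refine hl (v ⬝ᵥ u) ?_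
    rw [hi, vecMulVec_mulVec, op_smul_eq_smul]
  have hki : k ∈ Finset.univ.erase i₀ := by
    refine Finset.mem_erase.2 ⟨?_, Finset.mem_univ _⟩
    rintro rfl
    refine hk 0 ?_
    rw [hi, vecMulVec_mulVec]
    ext i
    simp [dotProduct]
    right
    ring
  have hQ : (Matrix.of ![![u 0, (A l *ᵥ u) 0], ![u 1, (A l *ᵥ u) 1]]).det ≠ 0 := by
    intro h0
    obtain ⟨t, ht⟩ := exists_smul_eq_of_det_eq_zero (w := A l *ᵥ u) hu (by
      rw [Matrix.det_fin_two] at h0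
      simp [mulVec, dotProduct] at h0 ⊢
      linarith)
    exact hl t ht
  have hP : (Matrix.of ![v, v ᵥ* A k]).det ≠ 0 := by
    intro h0
    obtain ⟨t, ht⟩ := exists_smul_eq_of_det_eq_zero (w := A k *ᵥ ![-v 1, v 0]) hv' (by
      rw [Matrix.det_fin_two] at h0
      simp [vecMul, mulVec, dotProduct] at h0 ⊢
      linarith)
    exact hk t ht
  obtain ⟨c, hc, hle⟩ := exists_alphaOne_le_entrySum_mul_mul hP hQ
  refine ⟨c, hc, fun n => ?_⟩
  set F : Matrix (Fin 2) (Fin 2) ℝ → ℝ := fun W => |v ⬝ᵥ W *ᵥ u| with hF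
  have hF0 : ∀ W, 0 ≤ F W := fun W => abs_nonneg _
  have hpt : ∀ W, c * alphaOne W ≤
      F W + F (A k * W) + (F (W * A l) + F (A k * (W * A l))) := by
    intro W
    refine (hle W).trans_eq ?_
    have e : ∀ x : Fin 2 → ℝ, x ⬝ᵥ (W * A l) *ᵥ u = x ⬝ᵥ W *ᵥ (A l *ᵥ u) := fun x => by
      rw [mulVec_mulVec]
    have e' : ∀ M, v ⬝ᵥ (A k * M) *ᵥ u = (v ᵥ* A k) ⬝ᵥ M *ᵥ u := fun M => by
      rw [← mulVec_mulVec, dotProduct_mulVec]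
    simp only [hF, e', e]
    generalize v ᵥ* A k = y
    generalize A l *ᵥ u = z
    simp only [entrySum, Fin.sum_univ_two, Matrix.mul_apply, dotProduct, mulVec, Matrix.of_apply,
      Matrix.cons_val_zero, Matrix.cons_val_one]
    ring_nf
  have h1 := wordSum_le_succ (A := A) (I := Finset.univ.erase i₀) (n := n) hF0 hki
  have h2 := wordSum_le_succ' (A := A) (I := Finset.univ.erase i₀) (n := n) hF0 hli
  have h3 := (wordSum_le_succ' (A := A) (n := n) (F := fun W => F (A k * W)) (fun _ => hF0 _) hli).trans
    (wordSum_le_succ (A := A) (n := n + 1) hF0 hki)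
  rw [← wordSum_const_mul]
  refine (wordSum_mono hpt).trans ?_
  rw [wordSum_add_apply, wordSum_add_apply, wordSum_add_apply]
  linarith

end Irreducible

/-! ### The comparison for dominated tuples -/

section Dominated

open Matrix

/-- The determinant of the pair of plane vectors `x`, `y`. -/
def planeCross (x y : EuclideanSpace ℝ (Fin 2)) : ℝ := x 0 * y 1 - x 1 * y 0

theorem planeCross_smul_right (t : ℝ) (x y : EuclideanSpace ℝ (Fin 2)) :
    planeCross x (t • y) = t * planeCross x y := by
  simp [planeCross]; ring

theorem planeCross_eq_zero_iff {x y : EuclideanSpace ℝ (Fin 2)} (hx : x ≠ 0) (hy : y ≠ 0) :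
    planeCross x y = 0 ↔ Projectivization.mk ℝ x hx = Projectivization.mk ℝ y hy := by
  rw [eq_comm (a := Projectivization.mk ℝ x hx), Projectivization.mk_eq_mk_iff']
  constructor
  · intro h
    obtain ⟨t, ht⟩ := exists_smul_eq_of_det_eq_zero (u := x.ofLp) (w := y.ofLp) (by simpa using hx) h
    exact ⟨t, by ext i; simpa using (congrFun ht i).symm⟩
  · rintro ⟨t, rfl⟩
    rw [planeCross_smul_right, planeCross]
    ring

theorem abs_planeCross_le (x y : EuclideanSpace ℝ (Fin 2)) :
    |planeCross x y| ≤ 2 * ‖x‖ * ‖y‖ := by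
  have hx := PiLp.norm_apply_le x
  have hy := PiLp.norm_apply_le y
  simp only [Real.norm_eq_abs] at hx hy
  refine (abs_sub _ _).trans ?_
  rw [abs_mul, abs_mul, mul_assoc, two_mul]
  gcongr <;> first | exact hx _ | exact hy _

theorem continuous_planeCross_right (x : EuclideanSpace ℝ (Fin 2)) : Continuous (planeCross x) := by
  unfold planeCross; fun_prop

/-- A line outside a closed cone makes an angle bounded below with all vectors of that cone. -/
theorem exists_mul_norm_le_abs_planeCross {S : Set (EuclideanSpace ℝ (Fin 2))} (hS : IsClosed S)
    (hsmul : ∀ y ∈ S, ∀ t : ℝ, t ≠ 0 → t • y ∈ S) {x : EuclideanSpace ℝ (Fin 2)}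
    (hx : ∀ y ∈ S, y ≠ 0 → planeCross x y ≠ 0) :
    ∃ c > 0, ∀ y ∈ S, c * ‖y‖ ≤ |planeCross x y| := by
  set K := Metric.sphere (0 : EuclideanSpace ℝ (Fin 2)) 1 ∩ S
  have hK : IsCompact K := (isCompact_sphere _ _).inter_right hS
  obtain ⟨c, hc, hle⟩ : ∃ c > 0, ∀ y ∈ K, c ≤ |planeCross x y| := by
    rcases K.eq_empty_or_nonempty with h | h
    · exact ⟨1, one_pos, by simp [h]⟩
    · obtain ⟨y, hy, hmin⟩ := hK.exists_isMinOn h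
        (continuous_planeCross_right x).abs.continuousOn
      refine ⟨|planeCross x y|, abs_pos.2 (hx y hy.2 ?_), fun z hz => hmin hz⟩
      rintro rfl
      simpa using hy.1
  refine ⟨c, hc, fun y hy => ?_⟩
  by_cases hy0 : y = 0
  · simp [hy0]
  have hn : 0 < ‖y‖ := norm_pos_iff.2 hy0
  have := hle (‖y‖⁻¹ • y) ⟨by simp [norm_smul, hn.ne'], hsmul y hy _ (inv_ne_zero hn.ne')⟩
  rw [planeCross_smul_right, abs_mul, abs_of_pos (inv_pos.2 hn), inv_mul_eq_div,
    le_div_iff₀ hn] at this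
  exact this

/-- The vectors that span a line in `C`, together with `0`. -/
def coneOver (C : Set RPOne) : Set (EuclideanSpace ℝ (Fin 2)) :=
  {y | ∀ h : y ≠ 0, Projectivization.mk ℝ y h ∈ C}

theorem zero_mem_coneOver (C : Set RPOne) : 0 ∈ coneOver C := fun h => absurd rfl h

theorem mk_smul_eq {y : EuclideanSpace ℝ (Fin 2)} {t : ℝ} (hy : y ≠ 0) (h : t • y ≠ 0) :
    Projectivization.mk ℝ (t • y) h = Projectivization.mk ℝ y hy :=
  (Projectivization.mk_eq_mk_iff' _ _ _ _ _).2 ⟨t, rfl⟩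

theorem smul_mem_coneOver {C : Set RPOne} {y : EuclideanSpace ℝ (Fin 2)} (hy : y ∈ coneOver C)
    (t : ℝ) : t • y ∈ coneOver C := by
  intro h
  have hy0 : y ≠ 0 := by rintro rfl; simp at h
  rw [mk_smul_eq hy0]
  exact hy hy0

theorem isClosed_coneOver_compl {U : Set RPOne} (hU : IsOpen U) : IsClosed (coneOver Uᶜ) := by
  have h1 : IsOpen ((Subtype.val : {v : EuclideanSpace ℝ (Fin 2) // v ≠ 0} → _) ''
      (Projectivization.mk' ℝ ⁻¹' U)) :=
    (IsOpen.isOpenMap_subtype_val isOpen_ne) _ (isOpen_coinduced.1 hU)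
  rw [← isOpen_compl_iff]
  convert h1
  ext y
  simp only [coneOver, Set.mem_compl_iff, Set.mem_ofPred_eq, not_forall, not_not, Set.mem_image,
    Set.mem_preimage, Subtype.exists, Projectivization.mk'_eq_mk]
  constructor
  · rintro ⟨h, hy⟩
    exact ⟨y, h, hy, rfl⟩
  · rintro ⟨y, h, hy, rfl⟩
    exact ⟨h, hy⟩

/-- The cone over an arc is the projection of a closed set along the compact parameter interval. -/
theorem IsMulticone.isClosed_coneOver {C : Set RPOne} (hC : IsMulticone C) :
    IsClosed (coneOver C) := by
  obtain ⟨-, -, F, hF, hint, rfl⟩ := hC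
  have hunion : coneOver (⋃₀ F) = {0} ∪ ⋃ S ∈ F, coneOver S := by
    ext y
    by_cases hy : y = 0
    · simp [hy, zero_mem_coneOver]
    · simp [coneOver, hy]
  rw [hunion]
  refine isClosed_singleton.union (hF.isClosed_biUnion fun S hS => ?_)
  obtain ⟨a, b, hab, -, rfl⟩ := hint S hS
  have hcl : IsClosed {q : Set.Icc a b × EuclideanSpace ℝ (Fin 2) |
      planeCross (unitVec q.1) q.2 = 0} := by
    refine isClosed_eq ?_ continuous_const
    simp only [planeCross, unitVec]
    simp only [Matrix.cons_val_zero, Matrix.cons_val_one]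
    fun_prop
  convert isClosedMap_snd_of_compactSpace _ hcl
  ext y
  simp only [coneOver, Set.mem_ofPred_eq, Set.mem_image, Prod.exists, Subtype.exists,
    exists_eq_right, lineAt]
  constructor
  · intro h
    by_cases hy : y = 0
    · exact ⟨a, Set.left_mem_Icc.2 hab.le, by simp [hy, planeCross]⟩
    · obtain ⟨θ, hθ, he⟩ := h hy
      exact ⟨θ, hθ, (planeCross_eq_zero_iff _ hy).2 he⟩
  · rintro ⟨θ, hθ, he⟩ hy
    exact ⟨θ, hθ, (planeCross_eq_zero_iff _ hy).1 he⟩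

/-- The complement of the cone is open, so a vector in it can be tilted slightly. -/
theorem IsMulticone.exists_planeCross_ne_zero {C : Set RPOne} (hC : IsMulticone C) :
    ∃ z₁ z₂, z₁ ∉ coneOver C ∧ z₂ ∉ coneOver C ∧ planeCross z₁ z₂ ≠ 0 := by
  obtain ⟨V, hV⟩ := (Set.ne_univ_iff_exists_notMem C).1 hC.2.1
  induction V using Projectivization.ind with
  | h y hy =>
  have hyC : y ∉ coneOver C := fun h => hV (h hy)
  set w : EuclideanSpace ℝ (Fin 2) := !₂[-y 1, y 0]
  have hcont : Filter.Tendsto (fun t : ℝ => y + t • w) (nhdsWithin 0 {0}ᶜ) (nhds y) := by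
    have : Filter.Tendsto (fun t : ℝ => y + t • w) (nhds 0) (nhds (y + (0 : ℝ) • w)) :=
      Continuous.tendsto (by fun_prop) 0
    rw [zero_smul, add_zero] at this
    exact this.mono_left nhdsWithin_le_nhds
  obtain ⟨t, ht, ht0⟩ := ((hcont.eventually
    (hC.isClosed_coneOver.isOpen_compl.mem_nhds hyC)).and self_mem_nhdsWithin).exists
  refine ⟨y, y + t • w, hyC, ht, ?_⟩
  have e : planeCross y (y + t • w) = t * ‖y‖ ^ 2 := by
    simp [planeCross, w, EuclideanSpace.norm_sq_eq, Fin.sum_univ_two]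
    ring
  rw [e]
  have : t ≠ 0 := ht0
  positivity

theorem MapsLine.exists_eq_mk {M : Matrix (Fin 2) (Fin 2) ℝ} {y : EuclideanSpace ℝ (Fin 2)}
    {hy : y ≠ 0} {W : RPOne} (h : MapsLine M (Projectivization.mk ℝ y hy) W) :
    ∃ h0 : Matrix.toEuclideanLin M y ≠ 0, W = Projectivization.mk ℝ _ h0 := by
  rw [MapsLine, Projectivization.submodule_mk, Submodule.map_span, Set.image_singleton] at h
  have h0 : Matrix.toEuclideanLin M y ≠ 0 := by
    intro h0
    rw [h0, Submodule.span_zero_singleton] at h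
    have := Projectivization.finrank_submodule W
    rw [← h, finrank_bot] at this
    exact zero_ne_one this
  refine ⟨h0, Projectivization.submodule_injective ?_⟩
  rw [Projectivization.submodule_mk, h]

/-- The adjugate has the same four entries up to order and sign. -/
theorem alphaOne_le_four_mul_alphaOne_adjugate (W : Matrix (Fin 2) (Fin 2) ℝ) :
    alphaOne W ≤ 4 * alphaOne W.adjugate := by
  refine (alphaOne_le_entrySum W).trans ?_
  have h := abs_entry_le_alphaOne W.adjugate
  have h00 := h 0 0
  have h01 := h 0 1
  have h10 := h 1 0
  have h11 := h 1 1
  rw [Matrix.adjugate_fin_two] at h00 h01 h10 h11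
  simp only [entrySum, Fin.sum_univ_two, Matrix.adjugate_fin_two] at *
  simp at h00 h01 h10 h11
  linarith

theorem planeCross_adjugate (W : Matrix (Fin 2) (Fin 2) ℝ) (x z : EuclideanSpace ℝ (Fin 2)) :
    planeCross x (Matrix.toEuclideanLin W.adjugate z) =
      planeCross (Matrix.toEuclideanLin W x) z := by
  simp [planeCross, Matrix.adjugate_fin_two, Matrix.mulVec, dotProduct, Fin.sum_univ_two]
  ring

variable {J : Type*} {A : J → Matrix (Fin 2) (Fin 2) ℝ}

/-- The image line of `A i₀` lies in the interior of `C` and its kernel outside `C`. Since `W u`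
stays in the cone, `|v ⬝ W u|` controls `‖W u‖`. The bound of the norm of `W` by `‖W u‖` comes by
duality through the adjugate, which needs no invertibility of `W`. -/
theorem IsDominatedTuple.exists_wordSum_le [Fintype J] [DecidableEq J] (h : IsDominatedTuple A)
    {i₀ : J} {u v : Fin 2 → ℝ} (hi : A i₀ = vecMulVec u v) (hu : u ≠ 0) (hv : v ≠ 0) :
    ∃ c > 0, ∀ n, c * wordSum A (Finset.univ.erase i₀) n alphaOne ≤
      wordSum A (Finset.univ.erase i₀) n (fun W => |v ⬝ᵥ W *ᵥ u|) := by
  obtain ⟨-, C, hC, hmap⟩ := h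
  set u' : EuclideanSpace ℝ (Fin 2) := WithLp.toLp 2 u with hu'
  have hu0 : u' ≠ 0 := by simpa [hu'] using hu
  set k : EuclideanSpace ℝ (Fin 2) := !₂[-v 1, v 0] with hk
  have hk0 : k ≠ 0 := by
    intro h0
    apply hv
    ext i
    fin_cases i
    · simpa [hk] using congrArg (fun y => y 1) h0
    · simpa [hk] using congrArg (fun y => y 0) h0
  have hT : ∀ y : EuclideanSpace ℝ (Fin 2),
      Matrix.toEuclideanLin (A i₀) y = (v 0 * y 0 + v 1 * y 1) • u' := by
    intro y
    ext i
    simp [hi, vecMulVec, mulVec, dotProduct, hu']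
    ring
  have huC : Projectivization.mk ℝ u' hu0 ∈ interior C := by
    obtain ⟨V, hV⟩ := hC.1
    induction V using Projectivization.ind with
    | h y hy =>
    obtain ⟨W, hW, hm⟩ := hmap i₀ _ hV
    obtain ⟨h0, rfl⟩ := hm.exists_eq_mk
    simp only [hT] at hW
    rwa [mk_smul_eq hu0] at hW
  have hkC : Projectivization.mk ℝ k hk0 ∉ C := by
    intro hk1
    obtain ⟨W, hW, hm⟩ := hmap i₀ _ hk1
    obtain ⟨h0, rfl⟩ := hm.exists_eq_mk
    apply h0
    rw [hT]
    have : v 0 * k 0 + v 1 * k 1 = 0 := by simp [hk]; ring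
    rw [this, zero_smul]
  obtain ⟨c₁, hc₁, h₁⟩ := exists_mul_norm_le_abs_planeCross hC.isClosed_coneOver
    (fun y hy t _ => smul_mem_coneOver hy t) (x := k) (fun y hy hy0 h0 =>
      hkC ((planeCross_eq_zero_iff hk0 hy0).1 h0 ▸ hy hy0))
  obtain ⟨c₂, hc₂, h₂⟩ := exists_mul_norm_le_abs_planeCross
    (isClosed_coneOver_compl (isOpen_interior (s := C)))
    (fun y hy t _ => smul_mem_coneOver hy t) (x := u') (fun y hy hy0 h0 =>
      hy hy0 ((planeCross_eq_zero_iff hu0 hy0).1 h0 ▸ huC))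
  obtain ⟨z₁, z₂, hz₁, hz₂, hz⟩ := hC.exists_planeCross_ne_zero
  have hQ : (Matrix.of ![![z₁ 0, z₂ 0], ![z₁ 1, z₂ 1]]).det ≠ 0 := by
    rw [Matrix.det_fin_two]
    simp only [planeCross] at hz
    simp
    intro h0
    apply hz
    linarith
  obtain ⟨c₃, hc₃, h₃⟩ := exists_alphaOne_le_entrySum_mul_mul (P := 1) (by simp) hQ
  let p : ℕ → Matrix (Fin 2) (Fin 2) ℝ → Prop := fun _ W => ∀ y (hy : y ≠ 0),
    Projectivization.mk ℝ y hy ∈ C →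
      ∃ h0 : Matrix.toEuclideanLin W y ≠ 0, Projectivization.mk ℝ _ h0 ∈ C
  have hp1 : p 0 1 := fun y hy hyC => by
    simpa [hy] using hyC
  have hp : ∀ n W j, p n W → p (n + 1) (A j * W) := by
    intro n W j hW y hy hyC
    obtain ⟨h0, h1⟩ := hW y hy hyC
    obtain ⟨V, hV, hm⟩ := hmap j _ h1
    obtain ⟨h2, rfl⟩ := hm.exists_eq_mk
    simp only [Matrix.toLpLin_mul_same, LinearMap.comp_apply]
    exact ⟨h2, interior_subset hV⟩
  -- If `adj W z` were in the interior cone, `W` would send it to a nonzero vector of the cone,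
  -- namely `det W • z`, forcing `z` into the cone.
  have hadj : ∀ n W, p n W → ∀ z ∉ coneOver C,
      Matrix.toEuclideanLin W.adjugate z ∈ coneOver (interior C)ᶜ := by
    intro n W hW z hzC hne hint
    obtain ⟨h0, h1⟩ := hW _ hne (interior_subset hint)
    have e : Matrix.toEuclideanLin W (Matrix.toEuclideanLin W.adjugate z) = W.det • z := by
      rw [← LinearMap.comp_apply, ← Matrix.toLpLin_mul_same, Matrix.mul_adjugate]
      simp
    simp only [e] at h0 h1
    refine hzC fun hz0 => ?_
    rwa [mk_smul_eq hz0] at h1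
  -- As `u'` is interior, it is transverse to `adj W z`; the adjugate then moves across `planeCross`
  -- to become `W` acting on `u'`.
  have hest : ∀ n W, p n W → ∀ z ∉ coneOver C,
      c₂ * ‖Matrix.toEuclideanLin W.adjugate z‖ ≤ 2 * ‖Matrix.toEuclideanLin W u'‖ * ‖z‖ :=
    fun n W hW z hzC => ((h₂ _ (hadj n W hW z hzC)).trans_eq (by rw [planeCross_adjugate])).trans
      (abs_planeCross_le _ _)
  have hv1 : ∀ n W, p n W → c₁ * ‖Matrix.toEuclideanLin W u'‖ ≤ |v ⬝ᵥ W *ᵥ u| := by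
    intro n W hW
    obtain ⟨h0, h1⟩ := hW u' hu0 (interior_subset huC)
    refine (h₁ _ fun _ => h1).trans_eq ?_
    rw [← abs_neg]
    congr 1
    simp [planeCross, hk, hu', dotProduct]
  have hsum : ∀ W : Matrix (Fin 2) (Fin 2) ℝ,
      entrySum (1 * W * Matrix.of ![![z₁ 0, z₂ 0], ![z₁ 1, z₂ 1]]) ≤
        2 * (‖Matrix.toEuclideanLin W z₁‖ + ‖Matrix.toEuclideanLin W z₂‖) := by
    intro W
    have e1 := PiLp.norm_apply_le (Matrix.toEuclideanLin W z₁)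
    have e2 := PiLp.norm_apply_le (Matrix.toEuclideanLin W z₂)
    have e10 := e1 0
    have e11 := e1 1
    have e20 := e2 0
    have e21 := e2 1
    simp only [Matrix.ofLp_toLpLin, Matrix.toLin'_apply, mulVec, dotProduct, Fin.sum_univ_two,
      Real.norm_eq_abs] at e10 e11 e20 e21
    simp only [entrySum, Fin.sum_univ_two, Matrix.one_mul, Matrix.mul_apply, Matrix.of_apply,
      Matrix.cons_val_zero, Matrix.cons_val_one]
    linarith
  set Z := ‖z₁‖ + ‖z₂‖ + 1
  have hZ : 0 < Z := by positivity
  have hpt : ∀ n W, p n W → c₁ * c₂ * c₃ / (16 * Z) * alphaOne W ≤ |v ⬝ᵥ W *ᵥ u| := by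
    intro n W hW
    rw [div_mul_eq_mul_div, div_le_iff₀ (by positivity)]
    have hz12 : ‖z₁‖ + ‖z₂‖ ≤ Z := by simp [Z]
    calc c₁ * c₂ * c₃ * alphaOne W
        ≤ c₁ * c₂ * c₃ * (4 * alphaOne W.adjugate) := by
          gcongr; exact alphaOne_le_four_mul_alphaOne_adjugate W
      _ = 4 * (c₁ * c₂) * (c₃ * alphaOne W.adjugate) := by ring
      _ ≤ 4 * (c₁ * c₂) * (2 * (‖Matrix.toEuclideanLin W.adjugate z₁‖ +
            ‖Matrix.toEuclideanLin W.adjugate z₂‖)) := by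
          exact mul_le_mul_of_nonneg_left ((h₃ _).trans (hsum _)) (by positivity)
      _ = 8 * c₁ * (c₂ * ‖Matrix.toEuclideanLin W.adjugate z₁‖ +
            c₂ * ‖Matrix.toEuclideanLin W.adjugate z₂‖) := by ring
      _ ≤ 8 * c₁ * (2 * ‖Matrix.toEuclideanLin W u'‖ * ‖z₁‖ +
            2 * ‖Matrix.toEuclideanLin W u'‖ * ‖z₂‖) := by
          exact mul_le_mul_of_nonneg_left
            (add_le_add (hest n W hW z₁ hz₁) (hest n W hW z₂ hz₂)) (by positivity)
      _ = 16 * (c₁ * ‖Matrix.toEuclideanLin W u'‖) * (‖z₁‖ + ‖z₂‖) := by ring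
      _ ≤ 16 * |v ⬝ᵥ W *ᵥ u| * Z := by
          gcongr; exact hv1 n W hW
      _ = _ := by ring
  refine ⟨c₁ * c₂ * c₃ / (16 * Z), by positivity, fun n => ?_⟩
  rw [← wordSum_const_mul]
  exact wordSum_le_of_forall hp1 hp (hpt n)

end Dominated

end

theorem mainTheorem2 {J : Type*} [Fintype J] (A : J → Matrix (Fin 2) (Fin 2) ℝ)
    (hA : ∀ i, ‖Matrix.toEuclideanCLM (𝕜 := ℝ) (A i)‖ < 1)
    (hdom : IsDominatedTuple A ∨ IsIrreducibleTuple A) :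
    ContinuousAt (fun s : ℝ => pressure A s) 1 ↔ ¬ ∃ i, (A i).rank = 1 := by
  classical
  have hA' : ∀ i, alphaOne (A i) ≤ 1 := fun i => by
    rw [← Matrix.norm_toEuclideanCLM_eq_alphaOne]
    exact (hA i).le
  constructor
  · rintro hcont ⟨i₀, hi₀⟩
    obtain ⟨hdet, hne⟩ := rank_eq_one_iff_det_eq_zero_and_ne_zero.1 hi₀
    obtain ⟨u, v, hu, hv, hi⟩ := exists_eq_vecMulVec_of_det_eq_zero hdet hne
    rcases hdom with h | h
    · obtain ⟨c, hc, hle⟩ := h.exists_wordSum_le hi hu hv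
      refine not_continuousAt_pressure_one hA' hi hc (fun n => ?_) hcont
      -- Domination bounds `z n` by `b n` alone; the other two terms are nonnegative.
      have h0 := fun n => wordSum_nonneg (A := A) (I := Finset.univ.erase i₀) (n := n)
        (F := fun W => |v ⬝ᵥ W.mulVec u|) fun _ => abs_nonneg _
      linarith [hle n, h0 (n + 1), h0 (n + 2)]
    · obtain ⟨c, hc, hle⟩ := h.exists_wordSum_le hi hu hv
      exact not_continuousAt_pressure_one hA' hi hc hle hcont
  · intro h
    push Not at h
    refine continuousAt_pressure_one hA' fun i hi => ?_
    by_contra hne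
    exact h i (rank_eq_one_iff_det_eq_zero_and_ne_zero.2 ⟨hi, hne⟩)
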